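/- Let $t=x_1^2+x_2^2+x_3^2-x_1x_2x_3-2\in\mathbb{C}[x_1,x_2,x_3]$, let $b\in\mathbb{C}$ with $b\neq\pm 2$, and let $M_b=\operatorname{Spec}\bigl(\mathbb{C}[x_1,x_2,x_3]/(t-b)\bigr)$, a smooth affine surface. Let $(\Omega^\bullet_{M_b},d)$ be its algebraic de Rham complex over $\mathbb{C}$ (the exterior powers of the module of Kähler differentials of the coordinate ring, with the exterior derivative), and let $$H^2=\frac{\ker(d:\Omega^2_{M_b}\to\Omega^3_{M_b})}{\operatorname{im}(d:\Omega^1_{M_b}\to\Omega^2_{M_b})}.$$ Then $\dim_{\mathbb{C}}H^2=5$. Moreover, the five $2$-forms $$f\,x_1\,dx_2\wedge dx_3,\qquad f\in\{1,\;x_1,\;x_2,\;x_3,\;x_1^2\},$$ on $M_b$ are closed, and their cohomology classes form a $\mathbb{C}$-basis of $H^2$. -/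

import Mathlib

open scoped KaehlerDifferential

noncomputable section

namespace AlgDeRham

section General

variable (R A : Type*) [CommRing R] [CommRing A] [Algebra R A]

/-- The exterior algebra over `A` of the module `Ω[A⁄R]` of Kähler differentials: the algebra of
all algebraic differential forms on `Spec A` over `R`. Its degree `n` part is `⋀[A]^n Ω[A⁄R]`. -/
abbrev Forms : Type _ := ExteriorAlgebra A Ω[A⁄R]

/-- The function `a ↦ da`, as a differential form of degree one. -/
def dFun (a : A) : Forms R A := ExteriorAlgebra.ι A (KaehlerDifferential.D R A a)

/-- Auxiliary: pairs of forms, on which `a : A` acts by `a • (x, y) = (a x, a y + da ∧ x)`.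
The map `x ↦ (x, dx)` is linear for this action; this is used to construct `d`. -/
@[ext]
structure Twist where
  fst : Forms R A
  snd : Forms R A

namespace Twist

variable {R A}

/-- `Twist` is additively the product of two copies of the forms. -/
def equivProd : Twist R A ≃ Forms R A × Forms R A where
  toFun p := (p.fst, p.snd)
  invFun p := ⟨p.1, p.2⟩
  left_inv _ := rfl
  right_inv _ := rfl

instance : AddCommGroup (Twist R A) := equivProd.addCommGroup

instance : Module R (Twist R A) := equivProd.module R

instance : SMul A (Twist R A) := ⟨fun a p => ⟨a • p.fst, a • p.snd + dFun R A a * p.fst⟩⟩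

@[simp] theorem fst_add (p q : Twist R A) : (p + q).fst = p.fst + q.fst := rfl
@[simp] theorem snd_add (p q : Twist R A) : (p + q).snd = p.snd + q.snd := rfl
@[simp] theorem fst_zero : (0 : Twist R A).fst = 0 := rfl
@[simp] theorem snd_zero : (0 : Twist R A).snd = 0 := rfl
@[simp] theorem fst_smul (a : A) (p : Twist R A) : (a • p).fst = a • p.fst := rfl
@[simp] theorem snd_smul (a : A) (p : Twist R A) :
    (a • p).snd = a • p.snd + dFun R A a * p.fst := rfl
@[simp] theorem fst_rsmul (r : R) (p : Twist R A) : (r • p).fst = r • p.fst := rfl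
@[simp] theorem snd_rsmul (r : R) (p : Twist R A) : (r • p).snd = r • p.snd := rfl

instance : Module A (Twist R A) where
  one_smul p := by ext <;> simp [dFun]
  mul_smul a b p := by
    ext
    · simp [mul_smul]
    · simp [dFun, mul_smul, add_mul, smul_add]
      abel_nf
  smul_zero a := by ext <;> simp
  smul_add a p q := by
    ext
    · simp
    · simp [mul_add]; abel
  add_smul a b p := by
    ext
    · simp [add_smul]
    · simp [dFun, add_smul, add_mul]; abel
  zero_smul p := by ext <;> simp [dFun]

instance : IsScalarTower R A (Twist R A) where
  smul_assoc r a p := by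
    ext
    · simp
    · simp [dFun]

end Twist

/-- The derivation `a ↦ (da, 0)`. -/
def twistDer : Derivation R A (Twist R A) :=
  Derivation.mk'
    { toFun := fun a => ⟨dFun R A a, 0⟩
      map_add' := fun a b => by ext <;> simp [dFun]
      map_smul' := fun r a => by ext <;> simp [dFun] }
    (fun a b => by
      ext
      · simp [dFun]
      · simp only [LinearMap.coe_mk, AddHom.coe_mk, Twist.snd_add, Twist.snd_smul, smul_zero,
          zero_add]
        exact (ExteriorAlgebra.ι_add_mul_swap _ _).symm)

/-- The exterior derivative on one-forms, `a db ↦ da ∧ db`. -/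
def dOne (ω : Ω[A⁄R]) : Forms R A := ((twistDer R A).liftKaehlerDifferential ω).snd

variable {R A}

theorem lift_twistDer_fst (ω : Ω[A⁄R]) :
    ((twistDer R A).liftKaehlerDifferential ω).fst = ExteriorAlgebra.ι A ω := by
  have h : ω ∈ Submodule.span A (Set.range (KaehlerDifferential.D R A)) := by
    rw [KaehlerDifferential.span_range_derivation]; trivial
  induction h using Submodule.span_induction with
  | mem x hx =>
    obtain ⟨a, rfl⟩ := hx
    rw [Derivation.liftKaehlerDifferential_comp_D]
    rfl
  | zero => simp
  | add x y _ _ hx hy => simp [hx, hy]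
  | smul a x _ hx => simp [hx]

theorem dOne_add (ω η : Ω[A⁄R]) : dOne R A (ω + η) = dOne R A ω + dOne R A η := by
  simp [dOne]

theorem dOne_smul (a : A) (ω : Ω[A⁄R]) :
    dOne R A (a • ω) = a • dOne R A ω + dFun R A a * ExteriorAlgebra.ι A ω := by
  simp [dOne, lift_twistDer_fst]

theorem dOne_D (a : A) : dOne R A (KaehlerDifferential.D R A a) = 0 := by
  rw [dOne, Derivation.liftKaehlerDifferential_comp_D]
  rfl

theorem ι_mul_ι_swap (x y : Ω[A⁄R]) :
    ExteriorAlgebra.ι A x * ExteriorAlgebra.ι A y =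
      - (ExteriorAlgebra.ι A y * ExteriorAlgebra.ι A x) :=
  eq_neg_of_add_eq_zero_left (ExteriorAlgebra.ι_add_mul_swap x y)

theorem dOne_mul_ι (ω η : Ω[A⁄R]) :
    dOne R A ω * ExteriorAlgebra.ι A η = ExteriorAlgebra.ι A η * dOne R A ω := by
  have h : ω ∈ Submodule.span A (Set.range (KaehlerDifferential.D R A)) := by
    rw [KaehlerDifferential.span_range_derivation]; trivial
  induction h using Submodule.span_induction with
  | mem x hx =>
    obtain ⟨a, rfl⟩ := hx
    simp [dOne_D]
  | zero => simp [dOne]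
  | add x y _ _ hx hy => simp [dOne_add, add_mul, mul_add, hx, hy]
  | smul a x _ hx =>
    rw [dOne_smul, add_mul, mul_add, smul_mul_assoc, hx, mul_smul_comm, dFun, mul_assoc,
      ι_mul_ι_swap x η, mul_neg, ← mul_assoc, ι_mul_ι_swap _ η, neg_mul, neg_neg, mul_assoc]

variable (R A)

/-- The endomorphism `(x, y) ↦ (ω ∧ x, dω ∧ x - ω ∧ y)`, for a one-form `ω`. -/
def twistMul : Ω[A⁄R] →ₗ[A] Module.End A (Twist R A) where
  toFun ω :=
    { toFun := fun p => ⟨ExteriorAlgebra.ι A ω * p.fst,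
        dOne R A ω * p.fst - ExteriorAlgebra.ι A ω * p.snd⟩
      map_add' := fun p q => by
        ext
        · simp [mul_add]
        · simp [mul_add]; abel
      map_smul' := fun a p => by
        ext
        · simp
        · simp only [Twist.fst_smul, Twist.snd_smul, mul_add, mul_smul_comm, RingHom.id_apply,
            smul_sub, ← mul_assoc]
          rw [dFun, ι_mul_ι_swap ω, neg_mul]
          abel }
  map_add' ω η := by
    ext p
    · simp [add_mul]
    · simp [dOne_add, add_mul]; abel
  map_smul' a ω := by
    ext p
    · simp
    · simp [dOne_smul, add_mul, smul_sub, mul_assoc]; abel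

theorem twistMul_sq (ω : Ω[A⁄R]) : twistMul R A ω * twistMul R A ω = 0 := by
  ext p
  · simp [twistMul, ← mul_assoc]
  · simp [twistMul, mul_sub, ← mul_assoc, dOne_mul_ι]

/-- The action of all forms on `Twist R A` that extends `twistMul`. -/
def twistLift : Forms R A →ₐ[A] Module.End A (Twist R A) :=
  ExteriorAlgebra.lift A ⟨twistMul R A, twistMul_sq R A⟩

/-- The exterior derivative `d` on the algebra of all algebraic differential forms. -/
def d : Forms R A →ₗ[R] Forms R A where
  toFun x := (twistLift R A x ⟨1, 0⟩).snd
  map_add' x y := by simp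
  map_smul' r x := by
    rw [← algebraMap_smul A r x, map_smul]
    simp

variable {R A}

theorem twistLift_fst (x : Forms R A) (p : Twist R A) :
    (twistLift R A x p).fst = x * p.fst := by
  induction x using CliffordAlgebra.left_induction generalizing p with
  | algebraMap r => simp [Algebra.smul_def]
  | add x y hx hy => simp [hx, hy, add_mul]
  | ι_mul x m hx =>
    rw [map_mul, Module.End.mul_apply, mul_assoc, ← hx p]
    change (twistLift R A (ExteriorAlgebra.ι A m) _).fst = _
    rw [twistLift, ExteriorAlgebra.lift_ι_apply]
    rfl

/-- `d` of the function `a` is `da`. -/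
theorem d_algebraMap (a : A) : d R A (algebraMap A _ a) = dFun R A a := by
  change (twistLift R A (algebraMap A _ a) ⟨1, 0⟩).snd = _
  simp

/-- The graded Leibniz rule for multiplication by a one-form. -/
theorem d_ι_mul (ω : Ω[A⁄R]) (x : Forms R A) :
    d R A (ExteriorAlgebra.ι A ω * x) = dOne R A ω * x - ExteriorAlgebra.ι A ω * d R A x := by
  change (twistLift R A (ExteriorAlgebra.ι A ω * x) ⟨1, 0⟩).snd = _
  rw [map_mul, Module.End.mul_apply]
  have h : twistLift R A (ExteriorAlgebra.ι A ω) = twistMul R A ω := by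
    rw [twistLift, ExteriorAlgebra.lift_ι_apply]
  rw [h]
  change dOne R A ω * (twistLift R A x ⟨1, 0⟩).fst - _ = _
  rw [twistLift_fst, mul_one]
  rfl

/-- The Leibniz rule for multiplication by a function. -/
theorem d_smul (a : A) (x : Forms R A) :
    d R A (a • x) = dFun R A a * x + a • d R A x := by
  change (twistLift R A (a • x) ⟨1, 0⟩).snd = _
  rw [map_smul, LinearMap.smul_apply, Twist.snd_smul, twistLift_fst, mul_one, add_comm]
  rfl

/-- On one-forms `d` is determined by `d (a db) = da ∧ db`. -/
theorem d_ι (ω : Ω[A⁄R]) : d R A (ExteriorAlgebra.ι A ω) = dOne R A ω := by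
  have h := d_ι_mul ω (1 : Forms R A)
  have h1 : d R A (1 : Forms R A) = 0 := by
    rw [← map_one (algebraMap A (Forms R A)), d_algebraMap]
    simp [dFun]
  simpa [h1] using h

/-- `d (da₁ ∧ ⋯ ∧ daₙ) = 0`. -/
theorem d_ιMulti_D {n : ℕ} (a : Fin n → A) :
    d R A (ExteriorAlgebra.ιMulti A n fun i => KaehlerDifferential.D R A (a i)) = 0 := by
  induction n with
  | zero =>
    rw [ExteriorAlgebra.ιMulti_zero_apply, ← map_one (algebraMap A (Forms R A)), d_algebraMap]
    simp [dFun]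
  | succ n ih =>
    rw [ExteriorAlgebra.ιMulti_succ_apply, d_ι_mul, dOne_D, zero_mul, zero_sub, neg_eq_zero]
    have := ih (fun i => a i.succ)
    simp only [Matrix.vecTail, Function.comp_def] at this ⊢
    rw [this, mul_zero]

/-- `d (a da₁ ∧ ⋯ ∧ daₙ) = da ∧ da₁ ∧ ⋯ ∧ daₙ`. -/
theorem d_smul_ιMulti_D {n : ℕ} (a : A) (b : Fin n → A) :
    d R A (a • ExteriorAlgebra.ιMulti A n fun i => KaehlerDifferential.D R A (b i)) =
      dFun R A a * ExteriorAlgebra.ιMulti A n fun i => KaehlerDifferential.D R A (b i) := by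
  rw [d_smul, d_ιMulti_D, smul_zero, add_zero]

/-- Every `n`-form is a sum of forms `a da₁ ∧ ⋯ ∧ daₙ`. -/
theorem form_induction {n : ℕ} {P : Forms R A → Prop} (h0 : P 0)
    (hadd : ∀ x y, P x → P y → P (x + y))
    (h : ∀ (a : A) (b : Fin n → A),
      P (a • ExteriorAlgebra.ιMulti A n fun i => KaehlerDifferential.D R A (b i)))
    {x : Forms R A} (hx : x ∈ ⋀[A]^n Ω[A⁄R]) : P x := by
  rw [← exteriorPower.ιMulti_span_fixedDegree_of_span_eq_top A n _
    (KaehlerDifferential.span_range_derivation R A)] at hx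
  induction hx using Submodule.closure_induction with
  | zero => exact h0
  | add x y _ _ hx hy => exact hadd x y hx hy
  | smul_mem a x hx =>
    obtain ⟨v, hv, rfl⟩ := hx
    choose b hb using fun i => hv ⟨i, rfl⟩
    have : v = fun i => KaehlerDifferential.D R A (b i) := funext fun i => (hb i).symm
    rw [this]
    exact h a b

theorem d_mem {n : ℕ} {x : Forms R A} (hx : x ∈ ⋀[A]^n Ω[A⁄R]) :
    d R A x ∈ ⋀[A]^(n + 1) Ω[A⁄R] := by
  refine form_induction (P := fun x => d R A x ∈ ⋀[A]^(n + 1) Ω[A⁄R]) ?_ ?_ ?_ hx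
  · simp
  · intro x y hx hy
    rw [map_add]
    exact add_mem hx hy
  · intro a b
    rw [d_smul_ιMulti_D, dFun]
    have := ExteriorAlgebra.ιMulti_range A (M := Ω[A⁄R]) (n + 1)
      ⟨Matrix.vecCons (KaehlerDifferential.D R A a) (fun i => KaehlerDifferential.D R A (b i)), rfl⟩
    rw [ExteriorAlgebra.ιMulti_succ_apply] at this
    simpa using this

theorem d_d {n : ℕ} {x : Forms R A} (hx : x ∈ ⋀[A]^n Ω[A⁄R]) : d R A (d R A x) = 0 := by
  refine form_induction (P := fun x => d R A (d R A x) = 0) ?_ ?_ ?_ hx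
  · simp
  · intro x y hx hy
    rw [map_add, map_add, hx, hy, add_zero]
  · intro a b
    rw [d_smul_ιMulti_D, dFun, d_ι_mul, dOne_D, d_ιMulti_D]
    simp

variable (R A)

/-- The `n`-forms `Ωⁿ = ⋀ⁿ Ω[A⁄R]` (exterior power over `A`), as an `R`-submodule of all forms.
With `d : Ωⁿ → Ωⁿ⁺¹` they make up the algebraic de Rham complex of `Spec A` over `R`. -/
def nForms (n : ℕ) : Submodule R (Forms R A) := (⋀[A]^n Ω[A⁄R]).restrictScalars R

/-- Closed `n`-forms. -/
def closedForms (n : ℕ) : Submodule R (Forms R A) := nForms R A n ⊓ LinearMap.ker (d R A)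

/-- Exact `n`-forms. -/
def exactForms : (n : ℕ) → Submodule R (Forms R A)
  | 0 => ⊥
  | n + 1 => (nForms R A n).map (d R A)

theorem exactForms_le_closedForms (n : ℕ) : exactForms R A n ≤ closedForms R A n := by
  cases n with
  | zero => exact bot_le
  | succ n =>
    rintro _ ⟨x, hx, rfl⟩
    exact ⟨d_mem hx, d_d hx⟩

/-- Algebraic de Rham cohomology `Hⁿ` of the affine scheme `Spec A` over `R`: closed `n`-forms
modulo exact `n`-forms. -/
abbrev deRham (n : ℕ) : Type _ :=
  closedForms R A n ⧸ (exactForms R A n).submoduleOf (closedForms R A n)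

variable {R A}

/-- The cohomology class of a closed form. -/
def deRhamClass {n : ℕ} (ω : Forms R A) (hω : ω ∈ closedForms R A n) : deRham R A n :=
  Submodule.Quotient.mk ⟨ω, hω⟩

end General

end AlgDeRham

section OneHoledTorus

open MvPolynomial

/-- The trace of the boundary, `t = x₁² + x₂² + x₃² - x₁ x₂ x₃ - 2`; the variables `x₁, x₂, x₃`
are `X 0, X 1, X 2`. -/
def torusTrace : MvPolynomial (Fin 3) ℂ :=
  X 0 ^ 2 + X 1 ^ 2 + X 2 ^ 2 - X 0 * X 1 * X 2 - 2

/-- The coordinate ring `ℂ[x₁, x₂, x₃] / (t - b)` of the fibre `M_b`. -/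
abbrev FibreRing (b : ℂ) : Type :=
  MvPolynomial (Fin 3) ℂ ⧸ Ideal.span {torusTrace - C b}

/-- The coordinate function on `M_b` of index `i`. -/
def fibreCoord (b : ℂ) (i : Fin 3) : FibreRing b :=
  Ideal.Quotient.mk (Ideal.span {torusTrace - C b}) (X i)

/-- The two-form `x₁ dx₂ ∧ dx₃` on `M_b`. -/
def baseForm (b : ℂ) : AlgDeRham.Forms ℂ (FibreRing b) :=
  fibreCoord b 0 • (AlgDeRham.dFun ℂ (FibreRing b) (fibreCoord b 1) *
    AlgDeRham.dFun ℂ (FibreRing b) (fibreCoord b 2))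

/-- The five functions `1, x₁, x₂, x₃, x₁²` on `M_b`. -/
def basisCoeff (b : ℂ) : Fin 5 → FibreRing b :=
  ![1, fibreCoord b 0, fibreCoord b 1, fibreCoord b 2, fibreCoord b 0 ^ 2]

end OneHoledTorus

end

/-! For `b ≠ ±2` the fibre carries a nowhere vanishing area form `σ = dx₂ ∧ dx₃ / (∂t/∂x₁)`, with
Poisson bracket `{x₁, x₂} = ∂t/∂x₃` and its cyclic rotations. Over the coordinate ring `A`, `σ`
freely generates the two-forms (`mem_span_areaForm`, `poisson_areaForm`). Since `da ∧ dxᵢ = {a, xᵢ}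
σ`, the exact two-forms are the span of all `{a, xᵢ} σ` (`exactForms_eq_span`). Hence `H²` is `A`
modulo brackets with coordinates, that is, polynomials modulo multiples of `t - b` and brackets.

On monomials these relations amount to the recursion `IsMoment` with `c = b + 2`
(`IsMoment.of_bracket`, `IsMoment.bracket_eq_zero`). It rewrites every monomial in lower total
degree, except `1, x₁, x₂, x₃` and the squares, which it identifies with one another. A solution is
therefore determined by five values (`IsMoment.apply_eq`), and any five values extend to a solution
(`isMoment_moment`). The recursion keeps only some of the bracket relations; the main point is that
it implies all the others. The solution whose initial values are the standard basis then identifies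
`H²` with `ℂ⁵`.

Finally `f x₁ dx₂ ∧ dx₃ = f x₁ (2 x₁ - x₂ x₃) σ`, and evaluating the recursion gives the coordinate
matrix of the five classes (`formCoord_basis`). Its determinant is a nonzero constant times `(b + 2)
(b - 2)⁴`. -/

noncomputable section

/-! ### The recursion on monomials: equivalence with the bracket relations, uniqueness and existence
of solutions -/

section Moments

variable {N : Type*} [AddCommGroup N] [Module ℂ N]

/-- The recursion satisfied by the classes of the monomials `x₁ⁱ x₂ʲ x₃ᵏ` modulo the equation
`x₁² + x₂² + x₃² - x₁ x₂ x₃ = c` and modulo Poisson brackets. -/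
structure IsMoment (c : ℂ) (φ : ℕ → ℕ → ℕ → N) : Prop where
  rel : ∀ i j k, φ (i + 1) (j + 1) (k + 1) =
    φ (i + 2) j k + φ i (j + 2) k + φ i j (k + 2) - c • φ i j k
  xy : ∀ i j, φ (i + 1) (j + 1) 0 = (2 : ℂ) • φ i j 1
  yz : ∀ j k, φ 0 (j + 1) (k + 1) = (2 : ℂ) • φ 1 j k
  zx : ∀ k i, φ (i + 1) 0 (k + 1) = (2 : ℂ) • φ i 1 k
  px : ∀ n : ℕ, (n + 3 : ℂ) • φ (n + 3) 0 0 = (4 : ℂ) • φ n 1 1 + ((n + 1) * c) • φ (n + 1) 0 0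
  py : ∀ n : ℕ, (n + 3 : ℂ) • φ 0 (n + 3) 0 = (4 : ℂ) • φ 1 n 1 + ((n + 1) * c) • φ 0 (n + 1) 0
  pz : ∀ n : ℕ, (n + 3 : ℂ) • φ 0 0 (n + 3) = (4 : ℂ) • φ 1 1 n + ((n + 1) * c) • φ 0 0 (n + 1)
  sq_xy : φ 2 0 0 = φ 0 2 0
  sq_yz : φ 0 2 0 = φ 0 0 2

/-- Cyclic rotation of the three exponents. -/
def rotate (φ : ℕ → ℕ → ℕ → N) : ℕ → ℕ → ℕ → N := fun i j k => φ k i j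

/-- The value on the monomial `x₁ⁱ x₂ʲ x₃ᵏ` of the composition of a functional with values `φ` on
monomials and the bracket with `x₁`. -/
def bracketX (φ : ℕ → ℕ → ℕ → N) (i j k : ℕ) : N :=
  ((j : ℂ) - k) • φ (i + 1) j k - (2 * j : ℂ) • φ i (j - 1) (k + 1)
    + (2 * k : ℂ) • φ i (j + 1) (k - 1)

/-- The analogue of `bracketX` for the variable `x₂`. -/
def bracketY (φ : ℕ → ℕ → ℕ → N) (i j k : ℕ) : N :=
  ((k : ℂ) - i) • φ i (j + 1) k - (2 * k : ℂ) • φ (i + 1) j (k - 1)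
    + (2 * i : ℂ) • φ (i - 1) j (k + 1)

/-- The analogue of `bracketX` for the variable `x₃`. -/
def bracketZ (φ : ℕ → ℕ → ℕ → N) (i j k : ℕ) : N :=
  ((i : ℂ) - j) • φ i j (k + 1) - (2 * i : ℂ) • φ (i - 1) (j + 1) k
    + (2 * j : ℂ) • φ (i + 1) (j - 1) k

variable {c : ℂ} {φ ψ : ℕ → ℕ → ℕ → N}

namespace IsMoment

/-! Values on multiples of `x₁ (2 x₁ - x₂ x₃)`. -/

theorem eval_one (h : IsMoment c φ) :
    (2 : ℂ) • φ 2 0 0 - φ 1 1 1 = c • φ 0 0 0 - φ 2 0 0 := by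
  have h1 := h.rel 0 0 0
  have h2 := h.sq_xy
  have h3 := h.sq_yz
  simp only [zero_add] at h1
  linear_combination (norm := module) (-1 : ℂ) • h1 + (2 : ℂ) • h2 + h3

theorem eval_x (h : IsMoment c φ) :
    (2 : ℂ) • φ 3 0 0 - φ 2 1 1 = (4 / 3 * (c - 4)) • φ 1 0 0 := by
  have h1 := h.rel 1 0 0
  have h2 := h.xy 0 1
  have h3 := h.zx 1 0
  have h4 := h.px 0
  have h5 := h.yz 0 0
  simp at h1 h2 h3 h4 h5
  linear_combination (norm := module) (-1 : ℂ) • h1 - h2 - h3 + (1 / 3 : ℂ) • h4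
    - (8 / 3 : ℂ) • h5

theorem eval_y (h : IsMoment c φ) :
    (2 : ℂ) • φ 2 1 0 - φ 1 2 1 = (2 / 3 * (c - 4)) • φ 0 1 0 := by
  have h1 := h.rel 0 1 0
  have h2 := h.xy 1 0
  have h3 := h.yz 0 1
  have h4 := h.py 0
  have h5 := h.zx 0 0
  simp at h1 h2 h3 h4 h5
  linear_combination (norm := module) (-1 : ℂ) • h1 + h2 - h3 - (1 / 3 : ℂ) • h4
    - (4 / 3 : ℂ) • h5

theorem eval_z (h : IsMoment c φ) :
    (2 : ℂ) • φ 2 0 1 - φ 1 1 2 = (2 / 3 * (c - 4)) • φ 0 0 1 := by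
  have h1 := h.rel 0 0 1
  have h2 := h.zx 0 1
  have h3 := h.yz 1 0
  have h4 := h.pz 0
  have h5 := h.xy 0 0
  simp at h1 h2 h3 h4 h5
  linear_combination (norm := module) (-1 : ℂ) • h1 + h2 - h3 - (1 / 3 : ℂ) • h4
    - (4 / 3 : ℂ) • h5

theorem eval_sq (h : IsMoment c φ) :
    (2 : ℂ) • φ 4 0 0 - φ 3 1 1 = (3 * c) • φ 0 0 0 + (3 / 2 * c - 9) • φ 2 0 0 := by
  have h1 := h.rel 2 0 0
  have h2 := h.xy 1 1
  have h3 := h.zx 1 1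
  have h4 := h.px 1
  have h5 := h.rel 0 0 0
  have h6 := h.sq_xy
  have h7 := h.sq_yz
  norm_num at h1 h2 h3 h4 h5
  linear_combination (norm := module) (-1 : ℂ) • h1 - h2 - h3 + (1 / 4 : ℂ) • h4
    - (3 : ℂ) • h5 + (6 : ℂ) • h6 + (3 : ℂ) • h7

/-- The recursion is symmetric under cyclic permutation of the variables, so results about brackets
with `x₁` transfer to `x₂` and `x₃`. -/
theorem rotate (h : IsMoment c φ) : IsMoment c (rotate φ) where
  rel i j k := by have := h.rel k i j; simp only [_root_.rotate]; rw [this]; abel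
  xy i j := h.yz i j
  yz j k := h.zx j k
  zx k i := h.xy k i
  px n := h.py n
  py n := h.pz n
  pz n := h.px n
  sq_xy := h.sq_yz
  sq_yz := (h.sq_xy.trans h.sq_yz).symm

/-- A relation on monomials divisible by `x₁ x₂ x₃` reduces to lower degree. -/
theorem bracketX_rel (h : IsMoment c φ) (i j k : ℕ) :
    bracketX φ (i + 1) (j + 1) (k + 1) = bracketX φ (i + 2) j k + bracketX φ i (j + 2) k
      + bracketX φ i j (k + 2) - c • bracketX φ i j k := by
  have h1 := h.rel (i + 1) j k
  -- The factor `j` is kept because for `j = 0` the exponent `j - 1` is truncated and only the zero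
  -- coefficient makes the equation true.
  have h2 : ((j : ℂ)) • φ (i + 1) j (k + 2) = (j : ℂ) • (φ (i + 2) (j - 1) (k + 1)
      + φ i (j + 1) (k + 1) + φ i (j - 1) (k + 3) - c • φ i (j - 1) (k + 1)) := by
    cases j with
    | zero => simp
    | succ j => rw [h.rel i j (k + 1)]; rfl
  have h3 : ((k : ℂ)) • φ (i + 1) (j + 2) k = (k : ℂ) • (φ (i + 2) (j + 1) (k - 1)
      + φ i (j + 3) (k - 1) + φ i (j + 1) (k + 1) - c • φ i (j + 1) (k - 1)) := by
    cases k with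
    | zero => simp
    | succ k => rw [h.rel i (j + 1) k]; rfl
  simp only [bracketX, Nat.add_sub_cancel, Nat.cast_add, Nat.cast_one, Nat.cast_ofNat,
    Nat.add_assoc, Nat.reduceAdd, Nat.reduceSub, Nat.add_sub_assoc, Nat.one_le_ofNat] at *
  linear_combination (norm := module) ((j : ℂ) - k) • h1 - (2 : ℂ) • h2 + (2 : ℂ) • h3

/-- For exponent one on `x₃` this is the equality of the squares of `x₂` and `x₃`; for higher
exponents it is `pz` before the mixed monomials are eliminated. -/
theorem bracketX_self (h : IsMoment c φ) (k : ℕ) : bracketX φ 0 1 (k + 1) = 0 := by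
  cases k with
  | zero => simp [bracketX, h.sq_yz]
  | succ k =>
    have h1 := h.rel 0 0 (k + 1)
    have h2 := h.pz k
    have h3 := h.zx k 1
    have h4 := h.yz 1 k
    simp [bracketX, Nat.add_assoc] at h1 h2 h3 h4 ⊢
    linear_combination (norm := module) (-k - 1 : ℂ) • h1 - h2
      - (k + 1 : ℂ) • h3 + (k + 3 : ℂ) • h4

end IsMoment

/-- The relation expressing that the form `e dt` vanishes, for a monomial `e`. -/
theorem bracket_dt (φ : ℕ → ℕ → ℕ → N) (i j k : ℕ) :
    (2 : ℂ) • bracketX φ (i + 1) j k + (2 : ℂ) • bracketY φ i (j + 1) k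
      + (2 : ℂ) • bracketZ φ i j (k + 1) = bracketX φ i (j + 1) (k + 1)
      + bracketY φ (i + 1) j (k + 1) + bracketZ φ (i + 1) (j + 1) k := by
  -- The splitting resolves the truncated exponents. The identity itself is `∑ {e ∂ᵢt, xᵢ} = {e, t}
  -- + e ∑ {∂ᵢt, xᵢ} = 0`.
  rcases i with _ | i <;> rcases j with _ | j <;> rcases k with _ | k <;>
  simp [bracketX, bracketY, bracketZ] <;> module

namespace IsMoment

/-- The counterpart of `bracketX_self` in which `x₃` has exponent one; here `py` plays the role of
`pz`. -/
theorem bracketX_self' (h : IsMoment c φ) (j : ℕ) : bracketX φ 0 (j + 1) 1 = 0 := by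
  cases j with
  | zero => exact h.bracketX_self 0
  | succ j =>
    have h1 := h.rel 0 (j + 1) 0
    have h2 := h.py j
    have h3 := h.xy 1 j
    have h4 := h.yz j 1
    simp [bracketX, Nat.add_assoc] at h1 h2 h3 h4 ⊢
    linear_combination (norm := module) (j + 1 : ℂ) • h1 + h2
      + (j + 1 : ℂ) • h3 - (j + 3 : ℂ) • h4

theorem bracketX_of_pos (h : IsMoment c φ) (i j k : ℕ)
    (ih : ∀ i' j' k', i' + j' + k' < i + j + k + 3 → bracketX φ i' j' k' = 0) :
    bracketX φ (i + 1) (j + 1) (k + 1) = 0 := by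
  rw [h.bracketX_rel, ih _ _ _ (by omega), ih _ _ _ (by omega), ih _ _ _ (by omega),
    ih _ _ _ (by omega)]
  simp

/-- If `x₂` or `x₃` is absent, the bracket is a multiple of `xy` or `zx`, or trivially zero. If all
variables occur, `bracketX_rel` lowers the degree. There remain the monomials without `x₁`: those
with exponent one somewhere are the two special lemmas, the others need `bracket_dt`. -/
theorem bracketX_step (h : IsMoment c φ) (n : ℕ)
    (ih : ∀ i j k, i + j + k < n → bracketX φ i j k = 0 ∧ bracketY φ i j k = 0 ∧
      bracketZ φ i j k = 0) (i j k : ℕ) (hn : i + j + k = n) : bracketX φ i j k = 0 := by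
  rcases j with _ | j
  · rcases k with _ | k
    · simp [bracketX]
    · have := h.zx k i
      simp [bracketX]
      linear_combination (norm := module) (-k - 1 : ℂ) • this
  rcases k with _ | k
  · have := h.xy i j
    simp [bracketX]
    linear_combination (norm := module) (j + 1 : ℂ) • this
  rcases i with _ | i
  swap
  · exact h.bracketX_of_pos i j k fun i' j' k' hl => (ih i' j' k' (by omega)).1
  rcases j with _ | j
  · exact h.bracketX_self k
  rcases k with _ | k
  · exact h.bracketX_self' (j + 1)
  -- In `bracket_dt` for `e = x₂ʲ⁺¹ x₃ᵏ⁺¹` the left side has lower degree, and the two companions of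
  -- the wanted bracket involve monomials divisible by `x₁ x₂ x₃`, which are already settled after
  -- rotation.
  have hY : bracketY φ 1 (j + 1) (k + 2) = 0 :=
    h.rotate.bracketX_of_pos j (k + 1) 0 fun i' j' k' hl => (ih k' i' j' (by omega)).2.1
  have hZ : bracketZ φ 1 (j + 2) (k + 1) = 0 :=
    h.rotate.rotate.bracketX_of_pos k 0 (j + 1) fun i' j' k' hl => (ih j' k' i' (by omega)).2.2
  have := bracket_dt φ 0 (j + 1) (k + 1)
  rw [(ih _ _ _ (by omega)).1, (ih _ _ _ (by omega)).2.1, (ih _ _ _ (by omega)).2.2] at this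
  simpa [hY, hZ] using this.symm

/-- The recursion implies that all brackets with coordinates vanish. -/
theorem bracket_eq_zero (h : IsMoment c φ) (i j k : ℕ) :
    bracketX φ i j k = 0 ∧ bracketY φ i j k = 0 ∧ bracketZ φ i j k = 0 := by
  induction hn : i + j + k using Nat.strong_induction_on generalizing i j k with
  | _ n ih =>
    have ih' : ∀ i j k, i + j + k < n → bracketX φ i j k = 0 ∧ bracketY φ i j k = 0 ∧
      bracketZ φ i j k = 0 := fun i j k hl => ih _ hl i j k rfl
    refine ⟨h.bracketX_step n ih' i j k hn, ?_, ?_⟩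
    · refine h.rotate.bracketX_step n (fun a b c hl => ?_) j k i (by omega)
      have := ih' c a b (by omega)
      exact ⟨this.2.1, this.2.2, this.1⟩
    · refine h.rotate.rotate.bracketX_step n (fun a b c hl => ?_) k i j (by omega)
      have := ih' b c a (by omega)
      exact ⟨this.2.2, this.1, this.2.1⟩

/-- The converse of `IsMoment.bracket_eq_zero`; the brackets with `x₃` are not needed. -/
theorem of_bracket (rel : ∀ i j k, φ (i + 1) (j + 1) (k + 1) =
      φ (i + 2) j k + φ i (j + 2) k + φ i j (k + 2) - c • φ i j k)
    (hX : ∀ i j k, bracketX φ i j k = 0) (hY : ∀ i j k, bracketY φ i j k = 0) :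
    IsMoment c φ := by
  have cancel : ∀ (n : ℕ) (v w : N), (n + 1 : ℂ) • (v - w) = 0 → v = w := fun n v w h =>
    sub_eq_zero.mp ((smul_eq_zero.mp h).resolve_left (Nat.cast_add_one_ne_zero n))
  have xy : ∀ i j, φ (i + 1) (j + 1) 0 = (2 : ℂ) • φ i j 1 := fun i j => by
    have := hX i (j + 1) 0
    simp [bracketX] at this
    refine cancel j _ _ ?_
    linear_combination (norm := module) this
  have yz : ∀ j k, φ 0 (j + 1) (k + 1) = (2 : ℂ) • φ 1 j k := fun j k => by
    have := hY 0 j (k + 1)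
    simp [bracketY] at this
    refine cancel k _ _ ?_
    linear_combination (norm := module) this
  have zx : ∀ k i, φ (i + 1) 0 (k + 1) = (2 : ℂ) • φ i 1 k := fun k i => by
    have := hX i 0 (k + 1)
    simp [bracketX] at this
    refine cancel k _ _ ?_
    linear_combination (norm := module) -this
  have sq1 := hX 0 1 1
  have sq2 := hY 1 0 1
  simp [bracketX, bracketY] at sq1 sq2
  refine ⟨rel, xy, yz, zx, fun n => ?_, fun n => ?_, fun n => ?_, ?_, ?_⟩
  -- The bracket of `x₁ⁿ⁺² x₃` with `x₂` involves `x₁ⁿ⁺² x₂ x₃`, `x₁ⁿ⁺³` and `x₁ⁿ⁺¹ x₃²`. Expanding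
  -- the first by `rel` and replacing `x₁ⁿ⁺¹ x₂²` and `x₁ⁿ⁺¹ x₃²` by `2 x₁ⁿ x₂ x₃` leaves `px`.
  · have h1 := rel (n + 1) 0 0
    have h2 := hY (n + 2) 0 1
    have h3 := xy n 1
    have h4 := zx 1 n
    simp [bracketY, Nat.add_assoc] at h1 h2 h3 h4 ⊢
    linear_combination (norm := module) (-1 : ℂ) • h2 - (n + 1 : ℂ) • h1
      - (n + 1 : ℂ) • h3 + (n + 3 : ℂ) • h4
  · have h1 := rel 0 (n + 1) 0
    have h2 := hX 0 (n + 2) 1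
    have h3 := xy 1 n
    have h4 := yz n 1
    simp [bracketX, Nat.add_assoc] at h1 h2 h3 h4 ⊢
    linear_combination (norm := module) h2 - (n + 1 : ℂ) • h1
      - (n + 1 : ℂ) • h3 + (n + 3 : ℂ) • h4
  · have h1 := rel 0 0 (n + 1)
    have h2 := hX 0 1 (n + 2)
    have h3 := zx n 1
    have h4 := yz 1 n
    simp [bracketX, Nat.add_assoc] at h1 h2 h3 h4 ⊢
    linear_combination (norm := module) (-1 : ℂ) • h2 - (n + 1 : ℂ) • h1
      - (n + 1 : ℂ) • h3 + (n + 3 : ℂ) • h4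
  · linear_combination (norm := module) (-1 / 2 : ℂ) • sq2 - (1 / 2 : ℂ) • sq1
  · linear_combination (norm := module) (1 / 2 : ℂ) • sq1

/-- Each clause of the recursion lowers the total degree, and the leading factor `n + 3` of the pure
powers is invertible over `ℂ`, so the five values propagate by induction on degree. -/
theorem apply_eq (hφ : IsMoment c φ) (hψ : IsMoment c ψ) (h0 : φ 0 0 0 = ψ 0 0 0)
    (h1 : φ 1 0 0 = ψ 1 0 0) (h2 : φ 0 1 0 = ψ 0 1 0) (h3 : φ 0 0 1 = ψ 0 0 1)
    (h4 : φ 2 0 0 = ψ 2 0 0) (i j k : ℕ) : φ i j k = ψ i j k := by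
  have cancel : ∀ (n : ℕ) (v w : N), (n + 3 : ℂ) • v = (n + 3 : ℂ) • w → v = w := fun n v w h => by
    refine smul_right_injective N (r := (n + 3 : ℂ)) ?_ h
    exact_mod_cast Nat.succ_ne_zero (n + 2)
  induction hn : i + j + k using Nat.strong_induction_on generalizing i j k with
  | _ n ih =>
    match i, j, k with
    | i + 1, j + 1, k + 1 =>
      rw [hφ.rel, hψ.rel, ih _ (by omega) _ _ _ rfl, ih _ (by omega) _ _ _ rfl,
        ih _ (by omega) _ _ _ rfl, ih _ (by omega) _ _ _ rfl]
    | i + 1, j + 1, 0 => rw [hφ.xy, hψ.xy, ih _ (by omega) _ _ _ rfl]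
    | 0, j + 1, k + 1 => rw [hφ.yz, hψ.yz, ih _ (by omega) _ _ _ rfl]
    | i + 1, 0, k + 1 => rw [hφ.zx, hψ.zx, ih _ (by omega) _ _ _ rfl]
    | m + 3, 0, 0 =>
      refine cancel m _ _ ?_
      rw [hφ.px, hψ.px, ih _ (by omega) _ _ _ rfl, ih _ (by omega) _ _ _ rfl]
    | 0, m + 3, 0 =>
      refine cancel m _ _ ?_
      rw [hφ.py, hψ.py, ih _ (by omega) _ _ _ rfl, ih _ (by omega) _ _ _ rfl]
    | 0, 0, m + 3 =>
      refine cancel m _ _ ?_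
      rw [hφ.pz, hψ.pz, ih _ (by omega) _ _ _ rfl, ih _ (by omega) _ _ _ rfl]
    | 0, 0, 0 => exact h0
    | 1, 0, 0 => exact h1
    | 0, 1, 0 => exact h2
    | 0, 0, 1 => exact h3
    | 2, 0, 0 => exact h4
    | 0, 2, 0 => rw [← hφ.sq_xy, ← hψ.sq_xy, h4]
    | 0, 0, 2 => rw [← hφ.sq_yz, ← hψ.sq_yz, ← hφ.sq_xy, ← hψ.sq_xy, h4]

theorem map {N' : Type*} [AddCommGroup N'] [Module ℂ N'] (h : IsMoment c φ) (f : N →ₗ[ℂ] N') :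
    IsMoment c fun i j k => f (φ i j k) where
  rel i j k := by rw [h.rel]; simp
  xy i j := by rw [h.xy]; simp
  yz i j := by rw [h.yz]; simp
  zx i j := by rw [h.zx]; simp
  px n := by simpa using congrArg f (h.px n)
  py n := by simpa using congrArg f (h.py n)
  pz n := by simpa using congrArg f (h.pz n)
  sq_xy := by rw [h.sq_xy]
  sq_yz := by rw [h.sq_yz]

end IsMoment

/-- The solution of the recursion `IsMoment c` with prescribed values on the monomials
`1, x₁, x₂, x₃, x₁²`. -/
def moment (c : ℂ) (v : Fin 5 → N) : ℕ → ℕ → ℕ → N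
  | i + 1, j + 1, k + 1 => moment c v (i + 2) j k + moment c v i (j + 2) k
      + moment c v i j (k + 2) - c • moment c v i j k
  | i + 1, j + 1, 0 => (2 : ℂ) • moment c v i j 1
  | 0, j + 1, k + 1 => (2 : ℂ) • moment c v 1 j k
  | i + 1, 0, k + 1 => (2 : ℂ) • moment c v i 1 k
  | n + 3, 0, 0 => (n + 3 : ℂ)⁻¹ •
      ((4 : ℂ) • moment c v n 1 1 + ((n + 1) * c) • moment c v (n + 1) 0 0)
  | 0, n + 3, 0 => (n + 3 : ℂ)⁻¹ •
      ((4 : ℂ) • moment c v 1 n 1 + ((n + 1) * c) • moment c v 0 (n + 1) 0)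
  | 0, 0, n + 3 => (n + 3 : ℂ)⁻¹ •
      ((4 : ℂ) • moment c v 1 1 n + ((n + 1) * c) • moment c v 0 0 (n + 1))
  | 0, 0, 0 => v 0
  | 1, 0, 0 => v 1
  | 0, 1, 0 => v 2
  | 0, 0, 1 => v 3
  | 2, 0, 0 => v 4
  | 0, 2, 0 => v 4
  | 0, 0, 2 => v 4
termination_by i j k => i + j + k

theorem isMoment_moment (c : ℂ) (v : Fin 5 → N) : IsMoment c (moment c v) := by
  have cancel : ∀ (n : ℕ) (v : N), (n + 3 : ℂ) • (n + 3 : ℂ)⁻¹ • v = v := fun n v =>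
    smul_inv_smul₀ (by exact_mod_cast Nat.succ_ne_zero (n + 2)) v
  constructor
  · intro i j k; rw [moment]
  · intro i j; rw [moment]
  · intro i j; rw [moment]
  · intro i j; rw [moment]
  · intro n; rw [moment, cancel]
  · intro n; rw [moment, cancel]
  · intro n; rw [moment, cancel]
  · rw [moment, moment]
  · rw [moment, moment]

end Moments

/-! ### Polynomials: Hamiltonian vector fields and functionals on monomials -/

section Polynomials

open MvPolynomial

variable {N : Type*} [AddCommGroup N] [Module ℂ N]

/-- The linear functional on polynomials with prescribed values on monomials. -/
def monomialMap (φ : ℕ → ℕ → ℕ → N) : MvPolynomial (Fin 3) ℂ →ₗ[ℂ] N :=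
  (basisMonomials (Fin 3) ℂ).constr ℂ fun m => φ (m 0) (m 1) (m 2)

theorem C_two : (C 2 : MvPolynomial (Fin 3) ℂ) = 2 := map_ofNat C 2

theorem monomial_eq_mul (m : Fin 3 →₀ ℕ) :
    monomial m (1 : ℂ) = X 0 ^ m 0 * X 1 ^ m 1 * X 2 ^ m 2 := by
  rw [monomial_eq, Finsupp.prod_fintype _ _ (by simp), Fin.prod_univ_three]
  simp

theorem monomialMap_apply (φ : ℕ → ℕ → ℕ → N) (i j k : ℕ) :
    monomialMap φ (X 0 ^ i * X 1 ^ j * X 2 ^ k) = φ i j k := by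
  have h := monomial_eq_mul (Finsupp.equivFunOnFinite.symm ![i, j, k])
  simp only [Finsupp.equivFunOnFinite_symm_apply_apply] at h
  simp at h
  rw [← h, monomialMap, ← congrFun (coe_basisMonomials (Fin 3) ℂ), Module.Basis.constr_basis]
  simp

theorem polynomial_lhom_ext {f g : MvPolynomial (Fin 3) ℂ →ₗ[ℂ] N}
    (h : ∀ i j k : ℕ, f (X 0 ^ i * X 1 ^ j * X 2 ^ k) = g (X 0 ^ i * X 1 ^ j * X 2 ^ k)) :
    f = g := by
  refine (basisMonomials (Fin 3) ℂ).ext fun m => ?_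
  simp only [coe_basisMonomials, monomial_eq_mul, h]

/-- The Hamiltonian vector fields `{·, xᵢ}` for the bracket with `{x₁, x₂} = ∂t/∂x₃` etc. -/
def hamiltonian (i : Fin 3) : Derivation ℂ (MvPolynomial (Fin 3) ℂ) (MvPolynomial (Fin 3) ℂ) :=
  mkDerivation ℂ (![![0, -(2 * X 2 - X 0 * X 1), 2 * X 1 - X 0 * X 2],
    ![2 * X 2 - X 0 * X 1, 0, -(2 * X 0 - X 1 * X 2)],
    ![-(2 * X 1 - X 0 * X 2), 2 * X 0 - X 1 * X 2, 0]] i)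

theorem hamiltonian_torusTrace (b : ℂ) (i : Fin 3) :
    hamiltonian i (torusTrace - C b) = 0 := by
  have h2 (D : Derivation ℂ (MvPolynomial (Fin 3) ℂ) (MvPolynomial (Fin 3) ℂ)) : D 2 = 0 := by
    simpa using D.map_natCast 2
  fin_cases i <;> simp [hamiltonian, torusTrace, Derivation.leibniz_pow, mkDerivation_X, h2] <;>
  ring

theorem apply_hamiltonian_zero (f : MvPolynomial (Fin 3) ℂ →ₗ[ℂ] N) (i j k : ℕ) :
    f (hamiltonian 0 (X 0 ^ i * X 1 ^ j * X 2 ^ k)) =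
      bracketX (fun i j k => f (X 0 ^ i * X 1 ^ j * X 2 ^ k)) i j k := by
  simp only [bracketX, ← map_smul, ← map_sub, ← map_add]
  congr 1
  rcases j with _ | j <;> rcases k with _ | k <;>
  simp [hamiltonian, Derivation.leibniz_pow, mkDerivation_X, smul_eq_C_mul, C_two] <;> ring

theorem apply_hamiltonian_one (f : MvPolynomial (Fin 3) ℂ →ₗ[ℂ] N) (i j k : ℕ) :
    f (hamiltonian 1 (X 0 ^ i * X 1 ^ j * X 2 ^ k)) =
      bracketY (fun i j k => f (X 0 ^ i * X 1 ^ j * X 2 ^ k)) i j k := by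
  simp only [bracketY, ← map_smul, ← map_sub, ← map_add]
  congr 1
  rcases i with _ | i <;> rcases k with _ | k <;>
  simp [hamiltonian, Derivation.leibniz_pow, mkDerivation_X, smul_eq_C_mul, C_two] <;> ring

theorem apply_hamiltonian_two (f : MvPolynomial (Fin 3) ℂ →ₗ[ℂ] N) (i j k : ℕ) :
    f (hamiltonian 2 (X 0 ^ i * X 1 ^ j * X 2 ^ k)) =
      bracketZ (fun i j k => f (X 0 ^ i * X 1 ^ j * X 2 ^ k)) i j k := by
  simp only [bracketZ, ← map_smul, ← map_sub, ← map_add]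
  congr 1
  rcases i with _ | i <;> rcases j with _ | j <;>
  simp [hamiltonian, Derivation.leibniz_pow, mkDerivation_X, smul_eq_C_mul, C_two] <;> ring

theorem mul_torusTrace (b : ℂ) (i j k : ℕ) :
    X 0 ^ i * X 1 ^ j * X 2 ^ k * (torusTrace - C b) =
      X 0 ^ (i + 2) * X 1 ^ j * X 2 ^ k + X 0 ^ i * X 1 ^ (j + 2) * X 2 ^ k
        + X 0 ^ i * X 1 ^ j * X 2 ^ (k + 2) - (b + 2) • (X 0 ^ i * X 1 ^ j * X 2 ^ k)
        - X 0 ^ (i + 1) * X 1 ^ (j + 1) * X 2 ^ (k + 1) := by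
  simp [torusTrace, smul_eq_C_mul, C_two]
  ring

/-- A functional that kills multiples of `t - b` and brackets satisfies the recursion. -/
theorem isMoment_of_apply {b : ℂ} {f : MvPolynomial (Fin 3) ℂ →ₗ[ℂ] N}
    (hrel : ∀ p, f (p * (torusTrace - C b)) = 0) (hham : ∀ i p, f (hamiltonian i p) = 0) :
    IsMoment (b + 2) fun i j k => f (X 0 ^ i * X 1 ^ j * X 2 ^ k) := by
  refine IsMoment.of_bracket (fun i j k => ?_) (fun i j k => ?_) fun i j k => ?_
  · have := hrel (X 0 ^ i * X 1 ^ j * X 2 ^ k)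
    rw [mul_torusTrace, map_sub, sub_eq_zero, map_sub, map_add, map_add, map_smul] at this
    exact this.symm
  · rw [← apply_hamiltonian_zero, hham]
  · rw [← apply_hamiltonian_one, hham]

theorem IsMoment.monomialMap_hamiltonian {c : ℂ} {φ : ℕ → ℕ → ℕ → N} (h : IsMoment c φ)
    (i : Fin 3) (p : MvPolynomial (Fin 3) ℂ) : monomialMap φ (hamiltonian i p) = 0 := by
  suffices monomialMap φ ∘ₗ (hamiltonian i).toLinearMap = 0 from LinearMap.congr_fun this p
  refine polynomial_lhom_ext fun a b c => ?_
  have key := h.bracket_eq_zero a b c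
  rw [LinearMap.comp_apply, Derivation.coeFn_coe,
    LinearMap.zero_apply]
  match i with
  | 0 => simpa only [apply_hamiltonian_zero, monomialMap_apply] using key.1
  | 1 => simpa only [apply_hamiltonian_one, monomialMap_apply] using key.2.1
  | 2 => simpa only [apply_hamiltonian_two, monomialMap_apply] using key.2.2

theorem IsMoment.monomialMap_mul_torusTrace {b : ℂ} {φ : ℕ → ℕ → ℕ → N}
    (h : IsMoment (b + 2) φ) (p : MvPolynomial (Fin 3) ℂ) :
    monomialMap φ (p * (torusTrace - C b)) = 0 := by
  suffices monomialMap φ ∘ₗ LinearMap.mulRight ℂ (torusTrace - C b) = 0 from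
    LinearMap.congr_fun this p
  refine polynomial_lhom_ext fun i j k => ?_
  rw [LinearMap.comp_apply, LinearMap.mulRight_apply, mul_torusTrace]
  simp only [map_sub, map_add, map_smul, monomialMap_apply, h.rel]
  simp

end Polynomials

/-! ### Differential forms on a surface in three-space with unimodular conormal vector -/

section Surface

open AlgDeRham

variable {R A : Type*} [CommRing R] [CommRing A] [Algebra R A]

theorem dFun_mul (f g : A) : dFun R A (f * g) = f • dFun R A g + g • dFun R A f := by
  simp [dFun]

theorem dFun_add (f g : A) : dFun R A (f + g) = dFun R A f + dFun R A g := by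
  simp [dFun]

theorem dFun_sub (f g : A) : dFun R A (f - g) = dFun R A f - dFun R A g := by
  simp [dFun]

theorem dFun_algebraMap (r : R) : dFun R A (algebraMap R A r) = 0 := by
  simp [dFun]

theorem dFun_mul_self (f : A) : dFun R A f * dFun R A f = 0 := by
  simp [dFun]

theorem dFun_mul_swap (f g : A) : dFun R A f * dFun R A g = -(dFun R A g * dFun R A f) :=
  ι_mul_ι_swap _ _

theorem forms_smul_smul (f g : A) (ω : Forms R A) : f • g • ω = (f * g) • ω :=
  smul_smul f g ω

theorem forms_zero_smul (ω : Forms R A) : (0 : A) • ω = 0 :=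
  zero_smul A ω

/-- The differentials of algebra generators generate the Kähler differentials. -/
theorem span_D_eq_top {ι : Type*} {x : ι → A} (hx : Algebra.adjoin R (Set.range x) = ⊤) :
    Submodule.span A (Set.range fun i => KaehlerDifferential.D R A (x i)) = ⊤ := by
  set W := Submodule.span A (Set.range fun i => KaehlerDifferential.D R A (x i))
  have h : W.mkQ.compDer (KaehlerDifferential.D R A) = 0 := by
    refine Derivation.ext_of_adjoin_eq_top _ hx ?_
    rintro _ ⟨i, rfl⟩
    exact (Submodule.Quotient.mk_eq_zero _).mpr (Submodule.subset_span ⟨i, rfl⟩)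
  rw [eq_top_iff, ← KaehlerDifferential.span_range_derivation, Submodule.span_le]
  rintro _ ⟨a, rfl⟩
  exact (Submodule.Quotient.mk_eq_zero _).mp (Derivation.congr_fun h a)

/-- The derivation `a ↦ da ∧ db`. -/
def wedgeDer (b : A) : Derivation R A (Forms R A) :=
  (LinearMap.mulRight A (dFun R A b) ∘ₗ ExteriorAlgebra.ι A).compDer (KaehlerDifferential.D R A)

theorem wedgeDer_apply (a b : A) : wedgeDer b a = dFun R A a * dFun R A b := rfl

/-- The matrix of Poisson brackets `{xᵢ, xⱼ}` on a surface with conormal vector `p`. -/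
def bracketMatrix (p : Fin 3 → A) : Matrix (Fin 3) (Fin 3) A :=
  !![0, p 2, -p 1; -p 2, 0, p 0; p 1, -p 0, 0]

variable (R) in
/-- The area form on a surface with coordinates `x`; the vector `u` is transversal to it. -/
def areaForm (x u : Fin 3 → A) : Forms R A :=
  u 0 • (dFun R A (x 1) * dFun R A (x 2)) + u 1 • (dFun R A (x 2) * dFun R A (x 0))
    + u 2 • (dFun R A (x 0) * dFun R A (x 1))

variable {x p u : Fin 3 → A}

/-- Wedging `∑ pᵢ dxᵢ = 0` with each `dxⱼ` shows that `(dx₂ ∧ dx₃, dx₃ ∧ dx₁, dx₁ ∧ dx₂)` has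
vanishing cross product with `p`; pairing with `u`, where `∑ uᵢ pᵢ = 1`, makes it `p` times the area
form. -/
theorem dFun_mul_coord (hp : ∑ i, p i • dFun R A (x i) = 0) (hu : ∑ i, u i * p i = 1)
    (i j : Fin 3) :
    dFun R A (x i) * dFun R A (x j) = bracketMatrix p i j • areaForm R x u := by
  rw [Fin.sum_univ_three] at hp hu
  have h0 := congrArg (dFun R A (x 0) * ·) hp
  have h1 := congrArg (dFun R A (x 1) * ·) hp
  have h2 := congrArg (dFun R A (x 2) * ·) hp
  simp only [mul_add, mul_smul_comm, dFun_mul_self, smul_zero, mul_zero, zero_add, add_zero,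
    dFun_mul_swap (x 1) (x 0), dFun_mul_swap (x 2) (x 0), dFun_mul_swap (x 2) (x 1)] at h0 h1 h2
  have e01 : dFun R A (x 0) * dFun R A (x 1) = p 2 • areaForm R x u := by
    rw [areaForm, dFun_mul_swap (x 2) (x 0)]
    linear_combination (norm := module) (-u 0) • h1 + u 1 • h0
      - hu • (dFun R A (x 0) * dFun R A (x 1))
  have e12 : dFun R A (x 1) * dFun R A (x 2) = p 0 • areaForm R x u := by
    rw [areaForm, dFun_mul_swap (x 2) (x 0)]
    linear_combination (norm := module) (-u 1) • h2 + u 2 • h1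
      - hu • (dFun R A (x 1) * dFun R A (x 2))
  have e02 : dFun R A (x 0) * dFun R A (x 2) = -p 1 • areaForm R x u := by
    rw [areaForm, dFun_mul_swap (x 2) (x 0)]
    linear_combination (norm := module) (-u 0) • h2 + u 2 • h0
      - hu • (dFun R A (x 0) * dFun R A (x 2))
  fin_cases i <;> fin_cases j <;>
  simp [bracketMatrix, dFun_mul_self, e01, e12, e02, dFun_mul_swap (x 1) (x 0),
    dFun_mul_swap (x 2) (x 0), dFun_mul_swap (x 2) (x 1)]

/-- Both sides are derivations in `a`, so it suffices to compare them on the generators `xⱼ`. -/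
theorem dFun_mul_coord_eq (hx : Algebra.adjoin R (Set.range x) = ⊤)
    (hp : ∑ i, p i • dFun R A (x i) = 0) (hu : ∑ i, u i * p i = 1) {i : Fin 3}
    {D : Derivation R A A} (hD : ∀ j, D (x j) = bracketMatrix p j i) (a : A) :
    dFun R A a * dFun R A (x i) = D a • areaForm R x u := by
  have h : wedgeDer (x i) = (LinearMap.toSpanSingleton A _ (areaForm R x u)).compDer D := by
    refine Derivation.ext_of_adjoin_eq_top _ hx ?_
    rintro _ ⟨j, rfl⟩
    rw [wedgeDer_apply, dFun_mul_coord hp hu, ← hD]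
    rfl
  exact Derivation.congr_fun h a

/-- In `db₀ ∧ db₁` the second factor can be expanded in the `dxᵢ`, and each `db₀ ∧ dxᵢ` is a bracket
times the area form. -/
theorem mem_span_areaForm (hx : Algebra.adjoin R (Set.range x) = ⊤)
    (hp : ∑ i, p i • dFun R A (x i) = 0) (hu : ∑ i, u i * p i = 1)
    {D : Fin 3 → Derivation R A A} (hD : ∀ i j, D i (x j) = bracketMatrix p j i)
    {ω : Forms R A} (hω : ω ∈ ⋀[A]^2 Ω[A⁄R]) : ω ∈ Submodule.span A {areaForm R x u} := by
  refine form_induction (zero_mem _) (fun _ _ => add_mem) (fun a b => ?_) hω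
  refine Submodule.smul_mem _ _ ?_
  have key : ∀ η : Ω[A⁄R],
      dFun R A (b 0) * ExteriorAlgebra.ι A η ∈ Submodule.span A {areaForm R x u} := fun η => by
    have hη : η ∈ Submodule.span A (Set.range fun i => KaehlerDifferential.D R A (x i)) :=
      span_D_eq_top hx ▸ Submodule.mem_top
    induction hη using Submodule.span_induction with
    | mem _ h =>
      obtain ⟨i, rfl⟩ := h
      exact Submodule.mem_span_singleton.mpr ⟨D i (b 0),
        (dFun_mul_coord_eq hx hp hu (hD i) (b 0)).symm⟩
    | zero => simp
    | add _ _ _ _ h1 h2 => rw [map_add, mul_add]; exact add_mem h1 h2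
    | smul a _ _ h => rw [map_smul, mul_smul_comm]; exact Submodule.smul_mem _ _ h
  rw [ExteriorAlgebra.ιMulti_apply, List.ofFn_succ, List.ofFn_succ]
  simpa [dFun] using key (KaehlerDifferential.D R A (b 1))

/-- Exact two-forms on a surface are spanned by Poisson brackets with coordinates. -/
theorem exactForms_eq_span (hx : Algebra.adjoin R (Set.range x) = ⊤)
    (hp : ∑ i, p i • dFun R A (x i) = 0) (hu : ∑ i, u i * p i = 1)
    {D : Fin 3 → Derivation R A A} (hD : ∀ i j, D i (x j) = bracketMatrix p j i) :
    exactForms R A 2 =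
      Submodule.span R (Set.range fun q : Fin 3 × A => D q.1 q.2 • areaForm R x u) := by
  have hd : ∀ i a, dOne R A (a • KaehlerDifferential.D R A (x i)) = D i a • areaForm R x u :=
    fun i a => by
      rw [dOne_smul, dOne_D, smul_zero, zero_add]
      exact dFun_mul_coord_eq hx hp hu (hD i) a
  apply le_antisymm
  · rintro _ ⟨ω, hω, rfl⟩
    obtain ⟨η, rfl⟩ : ω ∈ LinearMap.range (ExteriorAlgebra.ι A (M := Ω[A⁄R])) := by
      have : ω ∈ ⋀[A]^1 Ω[A⁄R] := hω
      rwa [ExteriorAlgebra.exteriorPower, pow_one] at this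
    rw [d_ι]
    have hη : η ∈ Submodule.span A (Set.range fun i => KaehlerDifferential.D R A (x i)) :=
      span_D_eq_top hx ▸ Submodule.mem_top
    clear hω
    induction hη using Submodule.closure_induction with
    | zero => simp [dOne]
    | add _ _ _ _ h1 h2 => rw [dOne_add]; exact add_mem h1 h2
    | smul_mem a _ h =>
      obtain ⟨i, rfl⟩ := h
      rw [hd]
      exact Submodule.subset_span ⟨(i, a), rfl⟩
  · rw [Submodule.span_le]
    rintro _ ⟨⟨i, a⟩, rfl⟩
    refine ⟨ExteriorAlgebra.ι A (a • KaehlerDifferential.D R A (x i)), ?_, ?_⟩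
    · change _ ∈ ⋀[A]^1 Ω[A⁄R]
      rw [ExteriorAlgebra.exteriorPower, pow_one]
      exact LinearMap.mem_range_self _ _
    · rw [d_ι, hd]

/-- There are no three-forms on a surface. -/
theorem areaForm_mul_dFun (hp : ∑ i, p i • dFun R A (x i) = 0) (hu : ∑ i, u i * p i = 1) :
    areaForm R x u * dFun R A (x 2) = 0 := by
  rw [Fin.sum_univ_three] at hp hu
  have h0 := congrArg (· * (dFun R A (x 1) * dFun R A (x 2))) hp
  have h1 := congrArg (dFun R A (x 0) * · * dFun R A (x 2)) hp
  have h2 := congrArg (dFun R A (x 0) * dFun R A (x 1) * ·) hp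
  have e (f g : A) : dFun R A f * dFun R A g * dFun R A g = 0 := by
    rw [mul_assoc, dFun_mul_self, mul_zero]
  have e' (f g : A) : dFun R A f * dFun R A g * dFun R A f = 0 := by
    rw [dFun_mul_swap, neg_mul, e, neg_zero]
  simp only [add_mul, mul_add, mul_smul_comm, smul_mul_assoc, ← mul_assoc, dFun_mul_self, e, e',
    smul_zero, mul_zero, zero_mul, zero_add, add_zero] at h0 h1 h2
  have h : dFun R A (x 0) * dFun R A (x 1) * dFun R A (x 2) = 0 := by
    linear_combination (norm := module) u 0 • h0 + u 1 • h1 + u 2 • h2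
      - hu • (dFun R A (x 0) * dFun R A (x 1) * dFun R A (x 2))
  simp only [areaForm, add_mul, smul_mul_assoc, e, e', h, smul_zero, add_zero]

/-- The differential is `da ∧ dx₂ ∧ dx₃`; its first two factors form a multiple of the area form,
which `dx₃` annihilates. -/
theorem smul_dFun_mul_dFun_mem_closedForms (hx : Algebra.adjoin R (Set.range x) = ⊤)
    (hp : ∑ i, p i • dFun R A (x i) = 0) (hu : ∑ i, u i * p i = 1)
    {D : Fin 3 → Derivation R A A} (hD : ∀ i j, D i (x j) = bracketMatrix p j i) (a : A) :
    a • (dFun R A (x 1) * dFun R A (x 2)) ∈ closedForms R A 2 := by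
  refine ⟨Submodule.smul_mem (⋀[A]^2 Ω[A⁄R]) a ?_, ?_⟩
  · rw [ExteriorAlgebra.exteriorPower, pow_two]
    exact Submodule.mul_mem_mul (LinearMap.mem_range_self _ _) (LinearMap.mem_range_self _ _)
  · change d R A _ = 0
    rw [d_smul, ← mul_assoc, dFun_mul_coord_eq hx hp hu (hD 1), smul_mul_assoc,
      areaForm_mul_dFun hp hu, smul_zero, zero_add]
    change a • d R A (ExteriorAlgebra.ι A _ * ExteriorAlgebra.ι A _) = 0
    rw [d_ι_mul, dOne_D, d_ι, dOne_D]
    simp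

/-- The linear functional on forms induced by two derivations: the contraction with their wedge
product. -/
def contract (D₁ D₂ : Derivation R A A) : Forms R A →ₗ[A] A :=
  ExteriorAlgebra.liftAlternating (Pi.single 2
    ((Matrix.detRowAlternating (R := A) (n := Fin 2)).compLinearMap
      (LinearMap.pi ![D₁.liftKaehlerDifferential, D₂.liftKaehlerDifferential])))

theorem contract_dFun_mul_dFun (D₁ D₂ : Derivation R A A) (f g : A) :
    contract D₁ D₂ (dFun R A f * dFun R A g) = D₁ f * D₂ g - D₂ f * D₁ g := by
  have h : dFun R A f * dFun R A g =
      ExteriorAlgebra.ιMulti A 2 ![KaehlerDifferential.D R A f, KaehlerDifferential.D R A g] := by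
    simp [ExteriorAlgebra.ιMulti_apply, dFun]
  rw [h, contract, ExteriorAlgebra.liftAlternating_apply_ιMulti]
  rw [Pi.single_eq_same]
  exact (Matrix.det_fin_two _).trans (by simp)

/-- The Poisson bivector as a functional on forms. -/
def poisson (u : Fin 3 → A) (D : Fin 3 → Derivation R A A) : Forms R A →ₗ[A] A :=
  u 0 • contract (D 1) (D 2) + u 1 • contract (D 2) (D 0) + u 2 • contract (D 0) (D 1)

/-- The contraction equals `(∑ uᵢ pᵢ)²`. Thus `poisson` recovers the coefficient of the area form,
which is what makes this generator free. -/
theorem poisson_areaForm (hu : ∑ i, u i * p i = 1)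
    {D : Fin 3 → Derivation R A A} (hD : ∀ i j, D i (x j) = bracketMatrix p j i) :
    poisson u D (areaForm R x u) = 1 := by
  rw [Fin.sum_univ_three] at hu
  simp [poisson, areaForm, contract_dFun_mul_dFun, hD, bracketMatrix]
  linear_combination (u 0 * p 0 + u 1 * p 1 + u 2 * p 2 + 1) * hu

end Surface

/-! ### The fibre: gradient, Hamiltonian fields and smoothness -/

section Fibre

open MvPolynomial AlgDeRham

variable (b : ℂ)

theorem map_torusTrace_sub {B : Type*} [CommRing B] (f : MvPolynomial (Fin 3) ℂ →+* B) :
    f (torusTrace - C b) =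
      f (X 0) ^ 2 + f (X 1) ^ 2 + f (X 2) ^ 2 - f (X 0) * f (X 1) * f (X 2) - 2 - f (C b) := by
  simp only [torusTrace, map_sub, map_add, map_mul, map_pow, map_ofNat]

theorem fibre_relation :
    fibreCoord b 0 ^ 2 + fibreCoord b 1 ^ 2 + fibreCoord b 2 ^ 2
      - fibreCoord b 0 * fibreCoord b 1 * fibreCoord b 2 = algebraMap ℂ _ (b + 2) := by
  have h : Ideal.Quotient.mk (Ideal.span {torusTrace - C b}) (torusTrace - C b) = 0 :=
    Ideal.Quotient.eq_zero_iff_mem.mpr (Ideal.mem_span_singleton_self _)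
  have h2 : algebraMap ℂ (FibreRing b) b = Ideal.Quotient.mk _ (C b) := rfl
  rw [map_torusTrace_sub] at h
  rw [map_add, h2, map_ofNat]
  simp only [fibreCoord]
  linear_combination h

theorem adjoin_fibreCoord : Algebra.adjoin ℂ (Set.range (fibreCoord b)) = ⊤ := by
  have h : Set.range (fibreCoord b) =
      Ideal.Quotient.mkₐ ℂ (Ideal.span {torusTrace - C b}) '' Set.range X := by
    rw [← Set.range_comp]; rfl
  rw [h, ← AlgHom.map_adjoin, adjoin_range_X, Algebra.map_top, AlgHom.range_eq_top]
  exact Ideal.Quotient.mkₐ_surjective _ _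

/-- Hamiltonian fields annihilate `t - b`, hence preserve the ideal it generates and descend to the
fibre. -/
theorem mk_hamiltonian_eq_zero (i : Fin 3) (p : MvPolynomial (Fin 3) ℂ)
    (hp : Ideal.Quotient.mkₐ ℂ (Ideal.span {torusTrace - C b}) p = 0) :
    Ideal.Quotient.mkₐ ℂ (Ideal.span {torusTrace - C b}) (hamiltonian i p) = 0 := by
  obtain ⟨q, rfl⟩ := Ideal.mem_span_singleton'.mp (Ideal.Quotient.eq_zero_iff_mem.mp hp)
  rw [Derivation.leibniz, hamiltonian_torusTrace, smul_zero, zero_add, smul_eq_mul]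
  exact Ideal.Quotient.eq_zero_iff_mem.mpr
    (Ideal.mul_mem_right _ _ (Ideal.mem_span_singleton_self _))

/-- The Hamiltonian vector field `{·, xᵢ}` on the fibre. -/
def fibreHamiltonian (i : Fin 3) : Derivation ℂ (FibreRing b) (FibreRing b) :=
  Derivation.liftOfSurjective
    (Ideal.Quotient.mkₐ_surjective ℂ (Ideal.span {torusTrace - C b})) (mk_hamiltonian_eq_zero b i)

theorem fibreHamiltonian_mk (i : Fin 3) (p : MvPolynomial (Fin 3) ℂ) :
    fibreHamiltonian b i (Ideal.Quotient.mk _ p) = Ideal.Quotient.mk _ (hamiltonian i p) :=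
  Derivation.liftOfSurjective_apply (f := Ideal.Quotient.mkₐ ℂ (Ideal.span {torusTrace - C b}))
    (Ideal.Quotient.mkₐ_surjective ℂ _) (mk_hamiltonian_eq_zero b i) p

/-- The gradient of the defining equation of the fibre. -/
def fibreGrad : Fin 3 → FibreRing b :=
  ![2 * fibreCoord b 0 - fibreCoord b 1 * fibreCoord b 2,
    2 * fibreCoord b 1 - fibreCoord b 0 * fibreCoord b 2,
    2 * fibreCoord b 2 - fibreCoord b 0 * fibreCoord b 1]

theorem fibreHamiltonian_coord (i j : Fin 3) :
    fibreHamiltonian b i (fibreCoord b j) = bracketMatrix (fibreGrad b) j i := by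
  have h : Ideal.Quotient.mk (Ideal.span {torusTrace - C b}) 2 = 2 := map_ofNat _ 2
  rw [fibreCoord, fibreHamiltonian_mk, hamiltonian, mkDerivation_X]
  fin_cases i <;> fin_cases j <;> simp [bracketMatrix, fibreGrad, fibreCoord, h]

theorem dFun_fibre_relation :
    ∑ i, fibreGrad b i • dFun ℂ (FibreRing b) (fibreCoord b i) = 0 := by
  have h := congrArg (dFun ℂ (FibreRing b)) (fibre_relation b)
  rw [dFun_algebraMap, dFun_sub, dFun_add, dFun_add, pow_two, pow_two, pow_two] at h
  simp only [dFun_mul] at h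
  simp only [Fin.sum_univ_three, fibreGrad, Matrix.cons_val]
  linear_combination (norm := module) h

/-- Coefficients expressing that `1` lies in the Jacobian ideal of the fibre. -/
def jacCoeff (i : Fin 3) : FibreRing b :=
  algebraMap ℂ _ (2 * (b + 2) * (2 - b))⁻¹ *
    ![4 * fibreCoord b 0 - fibreCoord b 0 ^ 3, algebraMap ℂ _ (2 - b) * fibreCoord b 1,
      2 * fibreCoord b 0 * fibreCoord b 1
        - fibreCoord b 2 * (fibreCoord b 0 ^ 2 + algebraMap ℂ _ (b - 2))] i

variable {b}

/-- The critical values of `t` are `-2`, attained at the origin, and `2`, attained at `(2, 2, 2)`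
and its sign changes with positive product. This accounts for the factors `b + 2` and `2 - b` that
have to be inverted. -/
theorem sum_jacCoeff_mul_fibreGrad (hb₁ : b ≠ 2) (hb₂ : b ≠ -2) :
    ∑ i, jacCoeff b i * fibreGrad b i = 1 := by
  have h0 : 2 * (b + 2) * (2 - b) ≠ 0 := by
    refine mul_ne_zero (mul_ne_zero two_ne_zero fun h => hb₂ ?_) fun h => hb₁ ?_
    · linear_combination h
    · linear_combination -h
  have h1 := congrArg (algebraMap ℂ (FibreRing b)) (inv_mul_cancel₀ h0)
  have h := fibre_relation b
  simp only [Fin.sum_univ_three, fibreGrad, jacCoeff, Matrix.cons_val]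
  generalize (2 * (b + 2) * (2 - b))⁻¹ = e at h1 ⊢
  simp only [map_add, map_sub, map_mul, map_ofNat, map_one] at h h1 ⊢
  linear_combination
    (-2 * (fibreCoord b 0 ^ 2 + algebraMap ℂ _ b - 2) * algebraMap ℂ _ e) * h + h1

end Fibre

/-! ### Coordinates on the second cohomology and the five classes -/

section Cohomology

open MvPolynomial AlgDeRham

/-- A linear map that vanishes on the kernel of a surjection descends. -/
def descend {K V W N : Type*} [Ring K] [AddCommGroup V] [AddCommGroup W] [AddCommGroup N]
    [Module K V] [Module K W] [Module K N] {π : V →ₗ[K] W} (hπ : Function.Surjective π)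
    {f : V →ₗ[K] N} (hf : ∀ v, π v = 0 → f v = 0) : W →ₗ[K] N :=
  (LinearMap.ker π).liftQ f hf ∘ₗ (π.quotKerEquivOfSurjective hπ).symm.toLinearMap

theorem descend_apply {K V W N : Type*} [Ring K] [AddCommGroup V] [AddCommGroup W]
    [AddCommGroup N] [Module K V] [Module K W] [Module K N] {π : V →ₗ[K] W}
    (hπ : Function.Surjective π) {f : V →ₗ[K] N} (hf : ∀ v, π v = 0 → f v = 0) (v : V) :
    descend hπ hf (π v) = f v := by
  have h : (π.quotKerEquivOfSurjective hπ).symm (π v) = (LinearMap.ker π).mkQ v := by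
    rw [LinearEquiv.symm_apply_eq]; rfl
  rw [descend, LinearMap.comp_apply, LinearEquiv.coe_coe, h]
  exact (LinearMap.ker π).liftQ_apply f v

variable (b : ℂ)

/-- The functional on polynomials that gives the coordinates with respect to
`1, x₁, x₂, x₃, x₁²` modulo `t - b` and Poisson brackets. -/
def polyCoord : MvPolynomial (Fin 3) ℂ →ₗ[ℂ] (Fin 5 → ℂ) :=
  monomialMap (moment (b + 2) fun i => Pi.single i 1)

theorem polyCoord_eq_zero (p : MvPolynomial (Fin 3) ℂ)
    (hp : (Ideal.Quotient.mkₐ ℂ (Ideal.span {torusTrace - C b})).toLinearMap p = 0) :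
    polyCoord b p = 0 := by
  obtain ⟨q, rfl⟩ := Ideal.mem_span_singleton'.mp (Ideal.Quotient.eq_zero_iff_mem.mp hp)
  exact (isMoment_moment _ _).monomialMap_mul_torusTrace q

/-- The coordinates of a function on the fibre with respect to `1, x₁, x₂, x₃, x₁²`, modulo
Poisson brackets. -/
def bracketCoord : FibreRing b →ₗ[ℂ] (Fin 5 → ℂ) :=
  descend (Ideal.Quotient.mkₐ_surjective ℂ (Ideal.span {torusTrace - C b}))
    (polyCoord_eq_zero b)

theorem bracketCoord_mk (p : MvPolynomial (Fin 3) ℂ) :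
    bracketCoord b (Ideal.Quotient.mk _ p) = polyCoord b p :=
  descend_apply (Ideal.Quotient.mkₐ_surjective ℂ (Ideal.span {torusTrace - C b}))
    (polyCoord_eq_zero b) p

theorem bracketCoord_fibreHamiltonian (i : Fin 3) (f : FibreRing b) :
    bracketCoord b (fibreHamiltonian b i f) = 0 := by
  obtain ⟨p, rfl⟩ := Ideal.Quotient.mk_surjective f
  rw [fibreHamiltonian_mk, bracketCoord_mk, polyCoord,
    (isMoment_moment _ _).monomialMap_hamiltonian]

theorem bracketCoord_monomial (i j k : ℕ) :
    bracketCoord b (fibreCoord b 0 ^ i * fibreCoord b 1 ^ j * fibreCoord b 2 ^ k) =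
      moment (N := Fin 5 → ℂ) (b + 2) (fun i => Pi.single i 1) i j k :=
  (bracketCoord_mk b (X 0 ^ i * X 1 ^ j * X 2 ^ k)).trans (monomialMap_apply _ i j k)

/-- The area form `dx₂ ∧ dx₃ / (2 x₁ - x₂ x₃)`. -/
abbrev fibreArea : Forms ℂ (FibreRing b) := areaForm ℂ (fibreCoord b) (jacCoeff b)

theorem smul_baseForm_eq_smul_wedge (f : FibreRing b) :
    f • baseForm b = (f * fibreCoord b 0) •
      (dFun ℂ (FibreRing b) (fibreCoord b 1) * dFun ℂ (FibreRing b) (fibreCoord b 2)) :=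
  forms_smul_smul f (fibreCoord b 0) _

variable {b}

theorem smul_baseForm (hb₁ : b ≠ 2) (hb₂ : b ≠ -2) (f : FibreRing b) :
    f • baseForm b = (f * fibreCoord b 0 * fibreGrad b 0) • fibreArea b := by
  rw [smul_baseForm_eq_smul_wedge, dFun_mul_coord (dFun_fibre_relation b)
    (sum_jacCoeff_mul_fibreGrad hb₁ hb₂)]
  exact forms_smul_smul _ (fibreGrad b 0) _

theorem smul_baseForm_mem_closedForms (hb₁ : b ≠ 2) (hb₂ : b ≠ -2) (f : FibreRing b) :
    f • baseForm b ∈ closedForms ℂ (FibreRing b) 2 := by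
  rw [smul_baseForm_eq_smul_wedge]
  exact smul_dFun_mul_dFun_mem_closedForms (adjoin_fibreCoord b) (dFun_fibre_relation b)
    (sum_jacCoeff_mul_fibreGrad hb₁ hb₂) (fibreHamiltonian_coord b) _

variable (b) in
/-- The coordinates of the class of a two-form. -/
def formCoord : Forms ℂ (FibreRing b) →ₗ[ℂ] (Fin 5 → ℂ) :=
  bracketCoord b ∘ₗ (poisson (jacCoeff b) (fibreHamiltonian b)).restrictScalars ℂ

theorem formCoord_smul (hb₁ : b ≠ 2) (hb₂ : b ≠ -2) (f : FibreRing b) :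
    formCoord b (f • fibreArea b) = bracketCoord b f := by
  rw [formCoord, LinearMap.comp_apply, LinearMap.restrictScalars_apply, map_smul,
    poisson_areaForm (sum_jacCoeff_mul_fibreGrad hb₁ hb₂) (fibreHamiltonian_coord b), smul_eq_mul,
    mul_one]

theorem exactForms_fibre (hb₁ : b ≠ 2) (hb₂ : b ≠ -2) :
    exactForms ℂ (FibreRing b) 2 = Submodule.span ℂ (Set.range fun q : Fin 3 × FibreRing b =>
      fibreHamiltonian b q.1 q.2 • fibreArea b) :=
  exactForms_eq_span (adjoin_fibreCoord b) (dFun_fibre_relation b)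
    (sum_jacCoeff_mul_fibreGrad hb₁ hb₂) (fibreHamiltonian_coord b)

theorem exactForms_le_ker_formCoord (hb₁ : b ≠ 2) (hb₂ : b ≠ -2) :
    exactForms ℂ (FibreRing b) 2 ≤ LinearMap.ker (formCoord b) := by
  rw [exactForms_fibre hb₁ hb₂, Submodule.span_le]
  rintro _ ⟨⟨i, f⟩, rfl⟩
  exact (formCoord_smul hb₁ hb₂ _).trans (bracketCoord_fibreHamiltonian b i f)

/-- A function whose coordinates vanish is a sum of brackets with coordinates. -/
theorem smul_fibreArea_mem_exactForms (hb₁ : b ≠ 2) (hb₂ : b ≠ -2) (f : FibreRing b)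
    (hf : bracketCoord b f = 0) : f • fibreArea b ∈ exactForms ℂ (FibreRing b) 2 := by
  -- The map `g` sends a polynomial to the class of its multiple of the area form modulo exact
  -- forms. It kills `t - b` and brackets, so its values on monomials are a solution of the
  -- recursion in this quotient.
  obtain ⟨g, hg⟩ : ∃ g : MvPolynomial (Fin 3) ℂ →ₗ[ℂ]
      Forms ℂ (FibreRing b) ⧸ exactForms ℂ (FibreRing b) 2, ∀ p, g p =
        (exactForms ℂ (FibreRing b) 2).mkQ
          (Ideal.Quotient.mk (Ideal.span {torusTrace - C b}) p • fibreArea b) :=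
    ⟨(exactForms ℂ (FibreRing b) 2).mkQ ∘ₗ
      ((LinearMap.toSpanSingleton (FibreRing b) _ (fibreArea b)).restrictScalars ℂ) ∘ₗ
      (Ideal.Quotient.mkₐ ℂ (Ideal.span {torusTrace - C b})).toLinearMap, fun _ => rfl⟩
  have h0 : (0 : FibreRing b) • fibreArea b = 0 := forms_zero_smul _
  have hmom : IsMoment (b + 2) fun i j k => g (X 0 ^ i * X 1 ^ j * X 2 ^ k) := by
    refine isMoment_of_apply (fun p => ?_) fun i p => ?_
    · rw [hg, Ideal.Quotient.eq_zero_iff_mem.mpr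
        (Ideal.mul_mem_left _ _ (Ideal.mem_span_singleton_self _)), h0, map_zero]
    · rw [hg, ← fibreHamiltonian_mk, Submodule.mkQ_apply, Submodule.Quotient.mk_eq_zero,
        exactForms_fibre hb₁ hb₂]
      exact Submodule.subset_span ⟨(i, _), rfl⟩
  let L := Fintype.linearCombination ℂ
    ![g 1, g (X 0), g (X 1), g (X 2), g (X 0 ^ 2)]
  -- Both sides solve the recursion with the same five initial values, so uniqueness factors `g`
  -- through the coordinates.
  have hL : g = L ∘ₗ polyCoord b := by
    refine polynomial_lhom_ext fun i j k => ?_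
    rw [LinearMap.comp_apply, polyCoord, monomialMap_apply]
    refine hmom.apply_eq ((isMoment_moment _ _).map L) ?_ ?_ ?_ ?_ ?_ i j k <;>
    simp [moment, L, Fintype.linearCombination_apply_single]
  obtain ⟨p, rfl⟩ := Ideal.Quotient.mk_surjective f
  rw [bracketCoord_mk] at hf
  rw [← Submodule.Quotient.mk_eq_zero, ← Submodule.mkQ_apply, ← hg, hL, LinearMap.comp_apply, hf,
    map_zero]

/-- The coordinates of the five classes. -/
theorem formCoord_basis (hb₁ : b ≠ 2) (hb₂ : b ≠ -2) (i : Fin 5) :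
    formCoord b (basisCoeff b i • baseForm b) =
      ![![b + 2, 0, 0, 0, -1], ![0, 4 / 3 * (b - 2), 0, 0, 0], ![0, 0, 2 / 3 * (b - 2), 0, 0],
        ![0, 0, 0, 2 / 3 * (b - 2), 0], ![3 * (b + 2), 0, 0, 0, 3 / 2 * b - 6]] i := by
  have hφ := isMoment_moment (b + 2) fun i : Fin 5 => (Pi.single i 1 : Fin 5 → ℂ)
  have key : ∀ i j k : ℕ, bracketCoord b
      (fibreCoord b 0 ^ i * fibreCoord b 1 ^ j * fibreCoord b 2 ^ k * fibreCoord b 0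
        * fibreGrad b 0) =
      (2 : ℂ) • moment (N := Fin 5 → ℂ) (b + 2) (fun i => Pi.single i 1) (i + 2) j k
        - moment (N := Fin 5 → ℂ) (b + 2) (fun i => Pi.single i 1) (i + 1) (j + 1) (k + 1) := fun i j k => by
    have h2 (f : FibreRing b) : (2 : ℂ) • bracketCoord b f = bracketCoord b (2 * f) := by
      rw [two_mul, map_add, two_smul]
    rw [← bracketCoord_monomial, ← bracketCoord_monomial, h2, ← map_sub]
    congr 1
    simp only [fibreGrad, Matrix.cons_val]
    ring
  rw [smul_baseForm hb₁ hb₂, formCoord_smul hb₁ hb₂]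
  -- With `c = b + 2`, the factor `c - 4` becomes `b - 2`, and `3 / 2 * c - 9` becomes `3 / 2 * b -
  -- 6`.
  have e0 := (key 0 0 0).trans hφ.eval_one
  have e1 := (key 1 0 0).trans hφ.eval_x
  have e2 := (key 0 1 0).trans hφ.eval_y
  have e3 := (key 0 0 1).trans hφ.eval_z
  have e4 := (key 2 0 0).trans hφ.eval_sq
  simp only [moment, pow_zero, pow_one, one_mul, mul_one] at e0 e1 e2 e3 e4
  fin_cases i
  · refine Eq.trans (by simp [basisCoeff]) (e0.trans ?_)
    ext j; fin_cases j <;> simp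
  · refine Eq.trans (by simp [basisCoeff]) (e1.trans ?_)
    ext j; fin_cases j <;> simp; ring
  · refine Eq.trans (by simp [basisCoeff]) (e2.trans ?_)
    ext j; fin_cases j <;> simp; ring
  · refine Eq.trans (by simp [basisCoeff]) (e3.trans ?_)
    ext j; fin_cases j <;> simp; ring
  · refine Eq.trans (by simp [basisCoeff]) (e4.trans ?_)
    ext j; fin_cases j <;> simp; ring

theorem linearIndependent_formCoord (hb₁ : b ≠ 2) (hb₂ : b ≠ -2) :
    LinearIndependent ℂ fun i => formCoord b (basisCoeff b i • baseForm b) := by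
  have h1 : b - 2 ≠ 0 := sub_ne_zero.mpr hb₁
  have h2 : b + 2 ≠ 0 := fun h => hb₂ (by linear_combination h)
  rw [Fintype.linearIndependent_iff]
  intro g hg
  simp only [formCoord_basis hb₁ hb₂] at hg
  have c0 := congrFun hg 0
  have c1 := congrFun hg 1
  have c2 := congrFun hg 2
  have c3 := congrFun hg 3
  have c4 := congrFun hg 4
  simp [Fin.sum_univ_five, h1] at c0 c1 c2 c3 c4
  -- Only the block of `1` and `x₁²` is not diagonal. Its first column gives `(b + 2) (g₀ + 3 g₄) =
  -- 0`; adding `g₀ + 3 g₄ = 0` to its second column gives `3/2 (b - 2) g₄ = 0`.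
  have g04 : g 0 + 3 * g 4 = 0 := by
    refine (mul_eq_zero.mp ?_).resolve_left h2
    linear_combination c0
  have g4 : g 4 = 0 := by
    refine (mul_eq_zero.mp ?_).resolve_left h1
    linear_combination (2 / 3 : ℂ) * (c4 + g04)
  have g0 : g 0 = 0 := by linear_combination g04 - 3 * g4
  intro i
  fin_cases i
  exacts [g0, c1, c2, c3, g4]

theorem closedForms_ker_formCoord (hb₁ : b ≠ 2) (hb₂ : b ≠ -2) {ω : Forms ℂ (FibreRing b)}
    (hω : ω ∈ closedForms ℂ (FibreRing b) 2) (h : formCoord b ω = 0) :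
    ω ∈ exactForms ℂ (FibreRing b) 2 := by
  obtain ⟨f, rfl⟩ := Submodule.mem_span_singleton.mp (mem_span_areaForm (adjoin_fibreCoord b)
    (dFun_fibre_relation b) (sum_jacCoeff_mul_fibreGrad hb₁ hb₂) (fibreHamiltonian_coord b) hω.1)
  rw [formCoord_smul hb₁ hb₂] at h
  exact smul_fibreArea_mem_exactForms hb₁ hb₂ f h

/-- The coordinates of a cohomology class. -/
def classCoord (hb₁ : b ≠ 2) (hb₂ : b ≠ -2) :
    deRham ℂ (FibreRing b) 2 →ₗ[ℂ] (Fin 5 → ℂ) :=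
  Submodule.liftQ _ (formCoord b ∘ₗ (closedForms ℂ (FibreRing b) 2).subtype)
    fun _ hω => exactForms_le_ker_formCoord hb₁ hb₂ hω

theorem classCoord_injective (hb₁ : b ≠ 2) (hb₂ : b ≠ -2) :
    Function.Injective (classCoord hb₁ hb₂) := by
  rw [← LinearMap.ker_eq_bot, LinearMap.ker_eq_bot']
  intro m hm
  obtain ⟨ω, rfl⟩ := Submodule.Quotient.mk_surjective _ m
  exact (Submodule.Quotient.mk_eq_zero _).mpr (closedForms_ker_formCoord hb₁ hb₂ ω.2 hm)

end Cohomology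

end

theorem theorem6p2 (b : ℂ) (hb₁ : b ≠ 2) (hb₂ : b ≠ -2) :
    Module.finrank ℂ (AlgDeRham.deRham ℂ (FibreRing b) 2) = 5 ∧
    ∃ (hclosed : ∀ i : Fin 5,
        basisCoeff b i • baseForm b ∈ AlgDeRham.closedForms ℂ (FibreRing b) 2)
      (B : Module.Basis (Fin 5) ℂ (AlgDeRham.deRham ℂ (FibreRing b) 2)),
      ∀ i : Fin 5, B i = AlgDeRham.deRhamClass (basisCoeff b i • baseForm b) (hclosed i) := by
  have hclosed := fun i => smul_baseForm_mem_closedForms hb₁ hb₂ (basisCoeff b i)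
  have hli : LinearIndependent ℂ fun i : Fin 5 =>
      AlgDeRham.deRhamClass (basisCoeff b i • baseForm b) (hclosed i) :=
    LinearIndependent.of_comp (classCoord hb₁ hb₂) (linearIndependent_formCoord hb₁ hb₂)
  have hinj := classCoord_injective hb₁ hb₂
  have : Module.Finite ℂ (AlgDeRham.deRham ℂ (FibreRing b) 2) := Module.Finite.of_injective _ hinj
  have hrank : Module.finrank ℂ (AlgDeRham.deRham ℂ (FibreRing b) 2) = 5 := by
    -- Injectivity of the coordinates bounds the dimension above, independence of the five classes
    -- bounds it below.
    refine le_antisymm ?_ ?_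
    · simpa using LinearMap.finrank_le_finrank_of_injective hinj
    · simpa using hli.fintype_card_le_finrank
  refine ⟨hrank, hclosed, basisOfLinearIndependentOfCardEqFinrank hli (by simp [hrank]),
    fun i => ?_⟩
  rw [coe_basisOfLinearIndependentOfCardEqFinrank]
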